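/- Let $\mathsf{Ab}_{t.f.}$ be the full subcategory of the category $\mathsf{Grp}$ of groups whose objects are the torsion-free abelian groups, with inclusion $H$, reflector $I\colon\mathsf{Grp}\to\mathsf{Ab}_{t.f.}$, $I(G)=G^{ab}/\mathrm{tors}(G^{ab})$, and unit $\eta_G\colon G\to HI(G)$. An \emph{extension} is a regular epimorphism (surjective homomorphism) of groups. An extension $f\colon E\to B$ is \emph{trivial} if the naturality square of $\eta$ at $f$ is a pullback; it is \emph{monadic} if the pullback functor $f^*$ from extensions of $B$ to extensions of $E$ is monadic; it is \emph{normal} if it is monadic and the projection $f^*(f)\colon E\times_BE\to E$ is trivial. A normal extension $p\colon E\to B$ is \emph{weakly universal} if for every normal extension $p'\colon E'\to B$ there is a homomorphism $u\colon E\to E'$ with $p'\circ u=p$. The \emph{Galois group} $\mathrm{Gal}(E,p,0)$ is the kernel of $\langle I(\pi_1),I(\pi_2)\rangle\colon I(E\times_BE)\to I(E)\times I(E)$ in $\mathsf{Ab}_{t.f.}$, and the \emph{fundamental group} $\pi_1(B)$ is $\mathrm{Gal}(E,p,0)$ for any weakly universal normal extension $p\colon E\to B$. Let $B$ be a group and $f\colon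 P\to B$ a surjective homomorphism with $P$ a free group and kernel $K$. Then $B$ has a weakly universal normal extension, and for every weakly universal normal extension $p\colon E\to B$ there is an isomorphism of groups $$\pi_1(B)=\mathrm{Gal}(E,p,0)\;\cong\;\frac{\{x\in K : \exists n\ge 1,\ x^n\in[P,P]\}}{\{x\in K : \exists n\ge 1,\ x^n\in[K,P]\}}.$$ (Both sets are subgroups of $P$, and the second is normal and contained in the first.) -/

import Mathlib

open CategoryTheory CategoryTheory.Limits

universe w v u

namespace GaloisPiOne

section Galois

/-- A Galois structure on a category with pullbacks: a full replete reflective subcategory `sub`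
with reflector `I` and adjunction `adj : I ⊣ H`, where `H = sub.ι` is the inclusion, together with
a class `ext` of morphisms (the extensions) which contains the isomorphisms, is closed under
composition, stable under pullback and preserved by `H ∘ I`. -/
structure GaloisStructure (A : Type u) [Category.{v} A] [HasPullbacks A] where
  sub : ObjectProperty A
  replete : sub.IsClosedUnderIsomorphisms
  I : A ⥤ sub.FullSubcategory
  adj : I ⊣ sub.ι
  ext : MorphismProperty A
  map_mem : ∀ {X Y : A} (f : X ⟶ Y), ext f → ext (sub.ι.map (I.map f))
  iso_mem : ∀ {X Y : A} (f : X ⟶ Y) [IsIso f], ext f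
  comp_mem : ∀ {X Y Z : A} (f : X ⟶ Y) (g : Y ⟶ Z), ext f → ext g → ext (f ≫ g)
  stable : ext.IsStableUnderBaseChange

variable {A : Type u} [Category.{v} A] [HasPullbacks A] (Γ : GaloisStructure A)

namespace GaloisStructure

/-- The full subcategory in which the reflector takes its values. -/
abbrev Sub : Type u := Γ.sub.FullSubcategory

/-- The unit of the reflection. -/
def η (X : A) : X ⟶ Γ.sub.ι.obj (Γ.I.obj X) := Γ.adj.unit.app X

/-- The pullback functor `p^*` from the extensions of `B` to the extensions of `E`, regarded as
full subcategories of the slice categories. -/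
noncomputable def pullbackFunctor {E B : A} (p : E ⟶ B) : Γ.ext.Over ⊤ B ⥤ Γ.ext.Over ⊤ E :=
  haveI := Γ.stable
  MorphismProperty.Over.pullback Γ.ext ⊤ p

/-- `p` is an extension and pulling back extensions along `p` is monadic. -/
def IsMonadicExtension {E B : A} (p : E ⟶ B) : Prop :=
  Γ.ext p ∧ Nonempty (MonadicRightAdjoint (Γ.pullbackFunctor p))

/-- `f` is an extension and its naturality square for the unit is a pullback. -/
def IsTrivialExtension {E B : A} (f : E ⟶ B) : Prop :=
  Γ.ext f ∧ IsPullback (Γ.η E) f (Γ.sub.ι.map (Γ.I.map f)) (Γ.η B)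

/-- `f` is a monadic extension and `f^*(f)`, a projection of its kernel pair, is trivial. -/
def IsNormalExtension {E B : A} (f : E ⟶ B) : Prop :=
  Γ.IsMonadicExtension f ∧ Γ.IsTrivialExtension (pullback.snd f f)

/-- A normal extension of `B` that factors through every normal extension of `B`. -/
def IsWeaklyUniversal {E B : A} (p : E ⟶ B) : Prop :=
  Γ.IsNormalExtension p ∧
    ∀ (E' : A) (p' : E' ⟶ B), Γ.IsNormalExtension p' → ∃ u : E ⟶ E', u ≫ p' = p

/-- The Galois group `Gal(E, p, 0)`: the pullback, in the subcategory, of `0 ⟶ I(E) × I(E)` along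
`⟨I(π₁), I(π₂)⟩ : I(E ×_B E) ⟶ I(E) × I(E)`. -/
noncomputable def galoisGroup [HasFiniteLimits Γ.Sub] [HasZeroObject Γ.Sub] {E B : A}
    (p : E ⟶ B) : Γ.Sub :=
  pullback (prod.lift (Γ.I.map (pullback.fst p p)) (Γ.I.map (pullback.snd p p)))
    ((isZero_zero Γ.Sub).to_ (Γ.I.obj E ⨯ Γ.I.obj E))

end GaloisStructure

end Galois

section TorsionFree

/-- The groups that are abelian and torsion-free. -/
def isAbTF : ObjectProperty GrpCat.{w} := fun G => IsMulCommutative G ∧ IsMulTorsionFree G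

/-- The category of torsion-free abelian groups, as a full subcategory of groups. -/
abbrev AbTF : Type (w + 1) := isAbTF.{w}.FullSubcategory

instance isAbTF_replete : isAbTF.{w}.IsClosedUnderIsomorphisms where
  of_iso {X Y} e h := by
    have hinj : Function.Injective e.inv.hom := e.symm.groupIsoToMulEquiv.injective
    obtain ⟨h1, h2⟩ := h
    refine ⟨⟨⟨fun a b => hinj ?_⟩⟩, ⟨fun n hn a b hab => hinj (h2.pow_left_injective hn ?_)⟩⟩
    · rw [map_mul, map_mul]
      exact h1.is_comm.comm _ _
    · have := congrArg e.inv.hom hab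
      simpa using this

/-- The composite of abelianisation with the quotient by the torsion subgroup. -/
abbrev ReflObj (G : Type w) [Group G] : Type w :=
  Abelianization G ⧸ CommGroup.torsion (Abelianization G)

/-- The canonical homomorphism from a group to its torsion-free abelian reflection. -/
def reflUnit (G : Type w) [Group G] : G →* ReflObj G :=
  (QuotientGroup.mk' (CommGroup.torsion (Abelianization G))).comp Abelianization.of

lemma reflUnit_surjective (G : Type w) [Group G] : Function.Surjective (reflUnit G) :=
  (QuotientGroup.mk'_surjective _).comp (QuotientGroup.mk'_surjective _)

lemma reflUnit_ker_le {G H : Type w} [Group G] [Group H] (h1 : IsMulCommutative H)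
    (h2 : IsMulTorsionFree H) (f : G →* H) : (reflUnit G).ker ≤ f.ker := by
  intro g hg
  let _ : CommGroup H := { (inferInstance : Group H) with mul_comm := h1.is_comm.comm }
  have hg' : Abelianization.of g ∈ CommGroup.torsion (Abelianization G) :=
    (QuotientGroup.eq_one_iff _).1 hg
  obtain ⟨n, hn, hgn⟩ := isOfFinOrder_iff_pow_eq_one.1 hg'
  have h3 : f g ^ n = 1 := by
    have := congrArg (Abelianization.lift f) hgn
    simpa using this
  exact h2.pow_left_injective hn.ne' (by simpa using h3)

/-- The torsion-free abelian reflection of a group, as an object of `AbTF`. -/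
def reflObj (G : GrpCat.{w}) : AbTF.{w} :=
  ⟨GrpCat.of (ReflObj G), ⟨⟨mul_comm⟩⟩, inferInstance⟩

/-- The factorisation through the reflection of a homomorphism to a torsion-free abelian group. -/
noncomputable def reflLift {G H : Type w} [Group G] [Group H] (h1 : IsMulCommutative H)
    (h2 : IsMulTorsionFree H) (f : G →* H) : ReflObj G →* H :=
  (reflUnit G).liftOfSurjective (reflUnit_surjective G) ⟨f, reflUnit_ker_le h1 h2 f⟩

lemma reflLift_reflUnit {G H : Type w} [Group G] [Group H] (h1 : IsMulCommutative H)
    (h2 : IsMulTorsionFree H) (f : G →* H) (g : G) :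
    reflLift h1 h2 f (reflUnit G g) = f g :=
  (reflUnit G).liftOfRightInverse_comp_apply _ _ ⟨f, reflUnit_ker_le h1 h2 f⟩ g

/-- The universal property of the reflection. -/
noncomputable def reflHomEquiv (G : GrpCat.{w}) (X : AbTF.{w}) :
    (reflObj G ⟶ X) ≃ (G ⟶ isAbTF.ι.obj X) where
  toFun φ := GrpCat.ofHom (φ.hom.hom.comp (reflUnit G))
  invFun f := ObjectProperty.homMk
    (GrpCat.ofHom (reflLift X.property.1 X.property.2 f.hom))
  left_inv φ := by
    ext x
    obtain ⟨g, rfl⟩ := reflUnit_surjective G x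
    exact reflLift_reflUnit X.property.1 X.property.2 _ g
  right_inv f := by
    ext g
    exact reflLift_reflUnit X.property.1 X.property.2 f.hom g

/-- The reflector from groups to torsion-free abelian groups. -/
noncomputable def reflector : GrpCat.{w} ⥤ AbTF.{w} :=
  Adjunction.leftAdjointOfEquiv (G := isAbTF.ι) reflHomEquiv (fun _ _ _ _ _ => rfl)

/-- The reflector is left adjoint to the inclusion. -/
noncomputable def reflAdj : reflector.{w} ⊣ isAbTF.ι :=
  Adjunction.adjunctionOfEquivLeft (G := isAbTF.ι) reflHomEquiv (fun _ _ _ _ _ => rfl)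

lemma isRegularEpi_iff_surjective {X Y : GrpCat.{w}} (f : X ⟶ Y) :
    IsRegularEpi f ↔ Function.Surjective f.hom := by
  constructor
  · intro h
    exact (GrpCat.epi_iff_surjective f).1 inferInstance
  · intro hf
    have key (s : Cofork (GrpCat.ofHom f.hom.ker.subtype) (GrpCat.ofHom 1)) :
        f.hom.ker ≤ s.π.hom.ker := fun x hx => by
      simpa using congrArg (fun g => g.hom (⟨x, hx⟩ : f.hom.ker)) s.condition
    have fac (s : Cofork (GrpCat.ofHom f.hom.ker.subtype) (GrpCat.ofHom 1)) (x : X) :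
        f.hom.liftOfSurjective hf ⟨s.π.hom, key s⟩ (f.hom x) = s.π.hom x :=
      f.hom.liftOfRightInverse_comp_apply _ (Function.rightInverse_surjInv hf)
        ⟨s.π.hom, key s⟩ x
    refine ⟨⟨{ W := GrpCat.of f.hom.ker
               left := GrpCat.ofHom f.hom.ker.subtype
               right := GrpCat.ofHom 1
               w := ?_
               isColimit := Cofork.IsColimit.mk _
                (fun s => GrpCat.ofHom (f.hom.liftOfSurjective hf ⟨s.π.hom, key s⟩))
                (fun s => ?_) (fun s m hm => ?_) }⟩⟩
    · ext x
      exact (MonoidHom.mem_ker.1 x.2).trans (map_one f.hom).symm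
    · ext x
      exact fac s x
    · ext y
      obtain ⟨x, rfl⟩ := hf y
      exact (congrArg (fun g => g.hom x) hm).trans (fac s x).symm

lemma reflAdj_unit_app (G : GrpCat.{w}) : reflAdj.unit.app G = GrpCat.ofHom (reflUnit G) := by
  rfl

/-- The Galois structure given by the reflection of groups to torsion-free abelian groups, the
extensions being the regular epimorphisms. -/
noncomputable def ΓTF : GaloisStructure GrpCat.{w} where
  sub := isAbTF
  replete := inferInstance
  I := reflector
  adj := reflAdj
  ext := MorphismProperty.regularEpi GrpCat
  map_mem {X Y} f hf := by
    rw [MorphismProperty.regularEpi_iff, isRegularEpi_iff_surjective] at hf ⊢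
    intro y
    obtain ⟨z, rfl⟩ := reflUnit_surjective Y y
    obtain ⟨x, rfl⟩ := hf z
    exact ⟨reflUnit X x, (congrArg (fun g => g.hom x) (reflAdj.unit.naturality f)).symm⟩
  iso_mem f _ := by
    rw [MorphismProperty.regularEpi_iff]
    infer_instance
  comp_mem f g hf hg := by
    rw [MorphismProperty.regularEpi_iff, isRegularEpi_iff_surjective] at hf hg ⊢
    exact hg.comp hf
  stable := MorphismProperty.IsStableUnderBaseChange.mk fun {X Y Y' S} f g f' g' sq hg => by
    rw [MorphismProperty.regularEpi_iff, isRegularEpi_iff_surjective] at hg ⊢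
    intro x
    obtain ⟨y, hy⟩ := hg (f x)
    obtain ⟨z, _, hz⟩ := Types.exists_of_isPullback (sq.map (forget GrpCat)) y x hy
    exact ⟨z, hz⟩

noncomputable instance : Reflective isAbTF.{w}.ι where
  L := reflector
  adj := reflAdj

instance : HasFiniteLimits ΓTF.{w}.Sub :=
  haveI : HasLimits isAbTF.{w}.FullSubcategory := hasLimits_of_reflective isAbTF.ι
  inferInstanceAs (HasFiniteLimits isAbTF.{w}.FullSubcategory)

instance : HasZeroObject ΓTF.{w}.Sub :=
  ⟨⟨GrpCat.of PUnit, ⟨⟨mul_comm⟩⟩, ⟨fun _ _ _ _ _ => Subsingleton.elim _ _⟩⟩,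
    IsZero.of_full_of_faithful_of_isZero isAbTF.ι _
      (GrpCat.isZero_of_subsingleton (GrpCat.of PUnit))⟩

end TorsionFree

section Isolator

variable {P : Type w} [Group P]

/-- For normal subgroups `K` and `N` of `P` with `[K, K] ≤ N`, the normal subgroup
`{p ∈ K | ∃ n ≥ 1, pⁿ ∈ N}` of `P`. -/
def rootsIn (K N : Subgroup P) [N.Normal] (h : ⁅K, K⁆ ≤ N) : Subgroup P where
  carrier := {p | p ∈ K ∧ ∃ n : ℕ, 0 < n ∧ p ^ n ∈ N}
  one_mem' := ⟨K.one_mem, 1, one_pos, by simp⟩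
  mul_mem' := by
    rintro a b ⟨ha, n, hn, han⟩ ⟨hb, m, hm, hbm⟩
    refine ⟨K.mul_mem ha hb, n * m, Nat.mul_pos hn hm, ?_⟩
    have hc : Commute (a : P ⧸ N) (b : P ⧸ N) := by
      rw [← commutatorElement_eq_one_iff_commute]
      exact (QuotientGroup.eq_one_iff _).2 (h (Subgroup.commutator_mem_commutator ha hb))
    rw [← QuotientGroup.eq_one_iff] at han hbm ⊢
    rw [QuotientGroup.mk_pow] at han hbm ⊢
    rw [QuotientGroup.mk_mul]
    rw [hc.mul_pow, pow_mul, han, mul_comm n m, pow_mul, hbm, one_pow, one_pow, one_mul]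
  inv_mem' := by
    rintro a ⟨ha, n, hn, han⟩
    exact ⟨K.inv_mem ha, n, hn, by rw [inv_pow]; exact N.inv_mem han⟩

instance rootsIn_normal (K N : Subgroup P) [hK : K.Normal] [hN : N.Normal] (h : ⁅K, K⁆ ≤ N) :
    (rootsIn K N h).Normal where
  conj_mem := by
    rintro a ⟨ha, n, hn, han⟩ g
    exact ⟨hK.conj_mem a ha g, n, hn, by rw [conj_pow]; exact hN.conj_mem _ han g⟩

/-- The numerator `{p ∈ K | ∃ n ≥ 1, pⁿ ∈ [P, P]}`. -/
def hopfNum (K : Subgroup P) [K.Normal] : Subgroup P :=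
  rootsIn K ⁅(⊤ : Subgroup P), ⊤⁆ (Subgroup.commutator_mono le_top le_top)

/-- The denominator `{p ∈ K | ∃ n ≥ 1, pⁿ ∈ [K, P]}`. -/
def hopfDen (K : Subgroup P) [K.Normal] : Subgroup P :=
  rootsIn K ⁅K, (⊤ : Subgroup P)⁆ (Subgroup.commutator_mono le_rfl le_top)

instance hopfDen_normal (K : Subgroup P) [K.Normal] : (hopfDen K).Normal :=
  rootsIn_normal _ _ _

/-- The denominator is contained in the numerator, so that the intersection with the numerator
taken in `HopfQuotient` changes nothing. -/
lemma hopfDen_le_hopfNum (K : Subgroup P) [K.Normal] : hopfDen K ≤ hopfNum K := by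
  rintro a ⟨ha, n, hn, han⟩
  exact ⟨ha, n, hn, Subgroup.commutator_mono le_top le_rfl han⟩

/-- The quotient group `{p ∈ K | ∃ n ≥ 1, pⁿ ∈ [P, P]} / {p ∈ K | ∃ n ≥ 1, pⁿ ∈ [K, P]}`. -/
abbrev HopfQuotient (K : Subgroup P) [K.Normal] : Type w :=
  hopfNum K ⧸ (hopfDen K).subgroupOf (hopfNum K)

end Isolator

end GaloisPiOne

namespace GaloisPiOne

section Pullback

variable {W X Y S : GrpCat.{w}} {fst : W ⟶ X} {snd : W ⟶ Y} {f : X ⟶ S} {g : Y ⟶ S}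

lemma exists_of_isPullback (h : IsPullback fst snd f g) (x : X) (y : Y)
    (hxy : f.hom x = g.hom y) : ∃ z : W, fst.hom z = x ∧ snd.hom z = y :=
  Types.exists_of_isPullback (h.map (forget GrpCat)) x y hxy

lemma ext_of_isPullback (h : IsPullback fst snd f g) {z z' : W}
    (h1 : fst.hom z = fst.hom z') (h2 : snd.hom z = snd.hom z') : z = z' :=
  Types.ext_of_isPullback (h.map (forget GrpCat)) h1 h2

lemma isPullback_of_exists_of_ext (w : fst ≫ f = snd ≫ g)
    (h1 : ∀ (x : X) (y : Y), f.hom x = g.hom y → ∃ z : W, fst.hom z = x ∧ snd.hom z = y)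
    (h2 : ∀ z : W, fst.hom z = 1 → snd.hom z = 1 → z = 1) : IsPullback fst snd f g := by
  refine IsPullback.of_map (forget GrpCat) w ((Types.isPullback_iff _ _ _ _).2 ⟨?_, ?_, h1⟩)
  · rw [← Functor.map_comp, w, Functor.map_comp]
  · rintro x y ⟨hx, hy⟩
    have hx' : fst.hom x = fst.hom y := hx
    have hy' : snd.hom x = snd.hom y := hy
    refine mul_inv_eq_one.1 (h2 _ ?_ ?_)
    · rw [map_mul, map_inv, hx', mul_inv_cancel]
    · rw [map_mul, map_inv, hy', mul_inv_cancel]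

end Pullback

section Monadic

/-- A parallel pair of extensions has as coequalizer any surjection which identifies its members
and whose kernel is generated, as a normal subgroup, by the quotients of their values. -/
lemma nonempty_isColimit_cofork {S : GrpCat.{w}}
    {X Y Z : ΓTF.{w}.ext.Over ⊤ S} (r s : X ⟶ Y) (π : Y ⟶ Z)
    (w : r ≫ π = s ≫ π) (hπ : Function.Surjective π.left.hom)
    (hker : π.left.hom.ker ≤
      Subgroup.normalClosure (Set.range fun x => r.left.hom x * (s.left.hom x)⁻¹)) :
    Nonempty (IsColimit (Cofork.ofπ π w)) := by
  have key (t : Cofork r s) : π.left.hom.ker ≤ t.π.left.hom.ker := by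
    refine hker.trans (Subgroup.normalClosure_le_normal ?_)
    rintro _ ⟨x, rfl⟩
    have h : t.π.left.hom (r.left.hom x) = t.π.left.hom (s.left.hom x) :=
      congrArg (fun k => k.left.hom x) t.condition
    change t.π.left.hom _ = 1
    rw [map_mul, map_inv, h, mul_inv_cancel]
  have fac (t : Cofork r s) (y : Y.left) :
      π.left.hom.liftOfSurjective hπ ⟨t.π.left.hom, key t⟩ (π.left.hom y) = t.π.left.hom y :=
    π.left.hom.liftOfRightInverse_comp_apply _ (Function.rightInverse_surjInv hπ)
      ⟨t.π.left.hom, key t⟩ y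
  refine ⟨Cofork.IsColimit.mk _
    (fun t => MorphismProperty.Over.homMk
      (GrpCat.ofHom (π.left.hom.liftOfSurjective hπ ⟨t.π.left.hom, key t⟩)) ?_)
    (fun t => ?_) (fun t m hm => ?_)⟩
  · ext z
    obtain ⟨y, rfl⟩ := hπ z
    refine (congrArg t.pt.hom.hom (fac t y)).trans ?_
    exact (congrArg (fun k => k.hom y) (MorphismProperty.Over.w t.π)).trans
      (congrArg (fun k => k.hom y) (MorphismProperty.Over.w π)).symm
  · ext y
    exact fac t y
  · ext z
    obtain ⟨y, rfl⟩ := hπ z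
    exact (congrArg (fun k => k.left.hom y) hm).trans (fac t y).symm

/-- The coequalizer of a parallel pair of extensions. -/
lemma exists_coequalizer {S : GrpCat.{w}}
    {X Y : ΓTF.{w}.ext.Over ⊤ S} (r s : X ⟶ Y) :
    ∃ (Z : ΓTF.{w}.ext.Over ⊤ S) (π : Y ⟶ Z), r ≫ π = s ≫ π ∧
      Function.Surjective π.left.hom ∧ π.left.hom.ker ≤
        Subgroup.normalClosure (Set.range fun x => r.left.hom x * (s.left.hom x)⁻¹) := by
  let N := Subgroup.normalClosure (Set.range fun x => r.left.hom x * (s.left.hom x)⁻¹)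
  have hY : Function.Surjective Y.hom.hom := (isRegularEpi_iff_surjective _).1 Y.prop
  have hN : N ≤ Y.hom.hom.ker := by
    refine Subgroup.normalClosure_le_normal ?_
    rintro _ ⟨x, rfl⟩
    have h1 : Y.hom.hom (r.left.hom x) = X.hom.hom x :=
      congrArg (fun k => k.hom x) (MorphismProperty.Over.w r)
    have h2 : Y.hom.hom (s.left.hom x) = X.hom.hom x :=
      congrArg (fun k => k.hom x) (MorphismProperty.Over.w s)
    change Y.hom.hom _ = 1
    rw [map_mul, map_inv, h1, h2, mul_inv_cancel]
  refine ⟨MorphismProperty.Over.mk ⊤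
      (GrpCat.ofHom (QuotientGroup.lift N Y.hom.hom hN) : GrpCat.of (Y.left ⧸ N) ⟶ S)
      ((isRegularEpi_iff_surjective _).2 fun b => ?_),
    MorphismProperty.Over.homMk (GrpCat.ofHom (QuotientGroup.mk' N)) ?_, ?_, ?_, ?_⟩
  · obtain ⟨y, rfl⟩ := hY b
    exact ⟨QuotientGroup.mk y, rfl⟩
  · rfl
  · ext x
    refine (QuotientGroup.eq_iff_div_mem (N := N)).2 ?_
    rw [div_eq_mul_inv]
    exact Subgroup.subset_normalClosure ⟨x, rfl⟩
  · exact QuotientGroup.mk'_surjective N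
  · exact (QuotientGroup.ker_mk' N).le

variable {E B : GrpCat.{w}} (p : E ⟶ B)

lemma pullbackFunctor_map_fst {X Y : ΓTF.{w}.ext.Over ⊤ B} (g : X ⟶ Y)
    (z : ((ΓTF.pullbackFunctor p).obj X).left) :
    (pullback.fst Y.hom p).hom (((ΓTF.pullbackFunctor p).map g).left.hom z) =
      g.left.hom ((pullback.fst X.hom p).hom z) :=
  congrArg (fun k => k.hom z) (pullback.lift_fst (pullback.fst X.hom p ≫ g.left)
    (pullback.snd X.hom p) (by rw [Category.assoc, MorphismProperty.Over.w, pullback.condition]))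

lemma pullbackFunctor_map_snd {X Y : ΓTF.{w}.ext.Over ⊤ B} (g : X ⟶ Y)
    (z : ((ΓTF.pullbackFunctor p).obj X).left) :
    (pullback.snd Y.hom p).hom (((ΓTF.pullbackFunctor p).map g).left.hom z) =
      (pullback.snd X.hom p).hom z :=
  congrArg (fun k => k.hom z) (pullback.lift_snd (pullback.fst X.hom p ≫ g.left)
    (pullback.snd X.hom p) (by rw [Category.assoc, MorphismProperty.Over.w, pullback.condition]))

variable {p}

lemma pullback_fst_surjective (hp : Function.Surjective p.hom) {X : GrpCat.{w}} (f : X ⟶ B) :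
    Function.Surjective (pullback.fst f p).hom := fun x => by
  obtain ⟨e, he⟩ := hp (f.hom x)
  obtain ⟨z, hz, -⟩ := exists_of_isPullback (IsPullback.of_hasPullback f p) x e he.symm
  exact ⟨z, hz⟩

lemma pullbackFunctor_reflectsIsomorphisms (hp : Function.Surjective p.hom) :
    (ΓTF.{w}.pullbackFunctor p).ReflectsIsomorphisms where
  reflects {X Y} g hg := by
    have hleft : IsIso ((ΓTF.pullbackFunctor p).map g).left :=
      inferInstanceAs (IsIso ((MorphismProperty.Over.forget _ _ _ ⋙ Over.forget E).map
        ((ΓTF.pullbackFunctor p).map g)))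
    have hbij : Function.Bijective ((ΓTF.pullbackFunctor p).map g).left.hom :=
      (asIso ((ΓTF.pullbackFunctor p).map g).left).groupIsoToMulEquiv.bijective
    have hinj : Function.Injective g.left.hom := by
      refine (injective_iff_map_eq_one _).2 fun x hx => ?_
      have hx1 : X.hom.hom x = 1 := by
        have h : Y.hom.hom (g.left.hom x) = X.hom.hom x :=
          congrArg (fun k => k.hom x) (MorphismProperty.Over.w g)
        rw [← h, hx, map_one]
      obtain ⟨z, hz1, hz2⟩ := exists_of_isPullback (IsPullback.of_hasPullback X.hom p) x 1
        (hx1.trans (map_one _).symm)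
      have hz : z = 1 := by
        refine hbij.1 (ext_of_isPullback (IsPullback.of_hasPullback Y.hom p) ?_ ?_)
        · refine (pullbackFunctor_map_fst p g z).trans ?_
          rw [hz1, hx]
          exact ((pullbackFunctor_map_fst p g 1).trans
            ((congrArg g.left.hom (map_one (pullback.fst X.hom p).hom)).trans (map_one _))).symm
        · refine (pullbackFunctor_map_snd p g z).trans ?_
          rw [hz2]
          exact ((pullbackFunctor_map_snd p g 1).trans
            (map_one (pullback.snd X.hom p).hom)).symm
      rw [← hz1, hz, map_one]
    have hsurj : Function.Surjective g.left.hom := fun y => by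
      obtain ⟨z, rfl⟩ := pullback_fst_surjective hp Y.hom y
      obtain ⟨t, rfl⟩ := hbij.2 z
      exact ⟨_, (pullbackFunctor_map_fst p g t).symm⟩
    have : IsIso g.left :=
      (MulEquiv.ofBijective g.left.hom ⟨hinj, hsurj⟩).toGrpIso.isIso_hom
    exact (MorphismProperty.Over.isoMk (asIso g.left) (MorphismProperty.Over.w g)).isIso_hom

lemma pullbackFunctor_map_ker_le (hp : Function.Surjective p.hom)
    {X Y Z : ΓTF.{w}.ext.Over ⊤ B} (r s : X ⟶ Y) (π : Y ⟶ Z)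
    (hker : π.left.hom.ker ≤
      Subgroup.normalClosure (Set.range fun x => r.left.hom x * (s.left.hom x)⁻¹)) :
    ((ΓTF.pullbackFunctor p).map π).left.hom.ker ≤
      Subgroup.normalClosure (Set.range fun x => ((ΓTF.pullbackFunctor p).map r).left.hom x *
        (((ΓTF.pullbackFunctor p).map s).left.hom x)⁻¹) := by
  intro z hz
  let M := Subgroup.normalClosure (Set.range fun x =>
    ((ΓTF.pullbackFunctor p).map r).left.hom x *
      (((ΓTF.pullbackFunctor p).map s).left.hom x)⁻¹)
  let fstY : ((ΓTF.pullbackFunctor p).obj Y).left ⟶ Y.left := pullback.fst Y.hom p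
  let sndY : ((ΓTF.pullbackFunctor p).obj Y).left ⟶ E := pullback.snd Y.hom p
  have hn : ((M ⊓ sndY.hom.ker).map fstY.hom).Normal :=
    Subgroup.Normal.map inferInstance _ (pullback_fst_surjective hp Y.hom)
  have hle : π.left.hom.ker ≤ (M ⊓ sndY.hom.ker).map fstY.hom := by
    refine hker.trans (Subgroup.normalClosure_le_normal ?_)
    rintro _ ⟨x, rfl⟩
    obtain ⟨t, rfl⟩ := pullback_fst_surjective hp X.hom x
    refine ⟨_, ⟨Subgroup.subset_normalClosure ⟨t, rfl⟩, ?_⟩, ?_⟩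
    · change sndY.hom _ = 1
      rw [map_mul, map_inv]
      exact mul_inv_eq_one.2
        ((pullbackFunctor_map_snd p r t).trans (pullbackFunctor_map_snd p s t).symm)
    · rw [map_mul, map_inv]
      exact congrArg₂ (· * ·⁻¹) (pullbackFunctor_map_fst p r t) (pullbackFunctor_map_fst p s t)
  replace hz : ((ΓTF.pullbackFunctor p).map π).left.hom z = 1 := hz
  have hz1 : π.left.hom (fstY.hom z) = 1 := by
    refine (pullbackFunctor_map_fst p π z).symm.trans ?_
    rw [hz]
    exact map_one _
  have hz2 : sndY.hom z = 1 := by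
    refine (pullbackFunctor_map_snd p π z).symm.trans ?_
    rw [hz]
    exact map_one _
  obtain ⟨m, ⟨hm, hm2⟩, hm1⟩ := hle hz1
  have : m = z := ext_of_isPullback (IsPullback.of_hasPullback Y.hom p) hm1
    ((MonoidHom.mem_ker.1 hm2).trans hz2.symm)
  exact this ▸ hm

lemma pullbackFunctor_map_surjective {Y Z : ΓTF.{w}.ext.Over ⊤ B} (π : Y ⟶ Z)
    (hπ : Function.Surjective π.left.hom) :
    Function.Surjective ((ΓTF.pullbackFunctor p).map π).left.hom := fun z => by
  obtain ⟨y, hy⟩ := hπ ((pullback.fst Z.hom p).hom z)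
  have h1 : Z.hom.hom (π.left.hom y) = Y.hom.hom y :=
    congrArg (fun k => k.hom y) (MorphismProperty.Over.w π)
  have h2 : Z.hom.hom ((pullback.fst Z.hom p).hom z) = p.hom ((pullback.snd Z.hom p).hom z) :=
    congrArg (fun k => k.hom z) (pullback.condition (f := Z.hom) (g := p))
  obtain ⟨t, ht1, ht2⟩ := exists_of_isPullback (IsPullback.of_hasPullback Y.hom p) y
    ((pullback.snd Z.hom p).hom z) (by rw [← h1, hy, h2])
  refine ⟨t, ext_of_isPullback (IsPullback.of_hasPullback Z.hom p) ?_ ?_⟩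
  · exact (pullbackFunctor_map_fst p π t).trans (by rw [ht1, hy])
  · exact (pullbackFunctor_map_snd p π t).trans ht2

/-- Surjective homomorphisms of groups are monadic extensions. -/
lemma isMonadicExtension_of_surjective (hp : Function.Surjective p.hom) :
    ΓTF.{w}.IsMonadicExtension p := by
  have hext : ΓTF.{w}.ext p := (isRegularEpi_iff_surjective p).2 hp
  have := ΓTF.{w}.stable
  have : ΓTF.{w}.ext.IsStableUnderComposition := ⟨fun f g => ΓTF.comp_mem f g⟩
  let adj : MorphismProperty.Over.map ⊤ hext ⊣ ΓTF.{w}.pullbackFunctor p :=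
    MorphismProperty.Over.mapPullbackAdj ΓTF.ext ⊤ p hext trivial
  have := pullbackFunctor_reflectsIsomorphisms hp
  have hhas : Monad.HasCoequalizerOfIsSplitPair (ΓTF.{w}.pullbackFunctor p) := ⟨fun r s _ => by
    obtain ⟨Z, π, w, hπ, hker⟩ := exists_coequalizer r s
    obtain ⟨hc⟩ := nonempty_isColimit_cofork r s π w hπ hker
    exact ⟨⟨⟨_, hc⟩⟩⟩⟩
  have hpres : Monad.PreservesColimitOfIsSplitPair (ΓTF.{w}.pullbackFunctor p) := ⟨fun r s _ => by
    obtain ⟨Z, π, w, hπ, hker⟩ := exists_coequalizer r s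
    obtain ⟨hc⟩ := nonempty_isColimit_cofork r s π w hπ hker
    obtain ⟨hc'⟩ := nonempty_isColimit_cofork ((ΓTF.pullbackFunctor p).map r)
      ((ΓTF.pullbackFunctor p).map s) ((ΓTF.pullbackFunctor p).map π)
      (by rw [← Functor.map_comp, w, Functor.map_comp])
      (pullbackFunctor_map_surjective π hπ) (pullbackFunctor_map_ker_le hp r s π hker)
    exact preservesColimit_of_preserves_colimit_cocone hc
      ((isColimitMapCoconeCoforkEquiv _ w).symm hc')⟩
  exact ⟨hext, ⟨Monad.monadicOfHasPreservesGSplitCoequalizersOfReflectsIsomorphisms adj⟩⟩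

end Monadic

section Normal

open scoped commutatorElement

lemma reflUnit_eq_one_iff {G : Type w} [Group G] (g : G) :
    reflUnit G g = 1 ↔ ∃ n : ℕ, 0 < n ∧ g ^ n ∈ ⁅(⊤ : Subgroup G), (⊤ : Subgroup G)⁆ := by
  refine (QuotientGroup.eq_one_iff _).trans (isOfFinOrder_iff_pow_eq_one.trans ?_)
  refine exists_congr fun n => and_congr_right fun _ => ?_
  rw [← map_pow]
  exact QuotientGroup.eq_one_iff _

lemma mem_hopfNum_iff {G : Type w} [Group G] (K : Subgroup G) [K.Normal] (g : G) :
    g ∈ hopfNum K ↔ g ∈ K ∧ reflUnit G g = 1 :=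
  and_congr_right' (reflUnit_eq_one_iff g).symm

lemma reflector_map_reflUnit {X Y : GrpCat.{w}} (f : X ⟶ Y) (x : X) :
    (ΓTF.sub.ι.map (ΓTF.I.map f)).hom (reflUnit X x) = reflUnit Y (f.hom x) :=
  congrArg (fun g => g.hom x) (reflAdj.unit.naturality f).symm

lemma isMulTorsionFree_reflObj (G : Type w) [Group G] : IsMulTorsionFree (ReflObj G) :=
  (reflObj (GrpCat.of G)).property.2

lemma reflUnit_eq_one_of_pow {G : Type w} [Group G] {g : G} {n : ℕ} (hn : 0 < n)
    (h : reflUnit G (g ^ n) = 1) : reflUnit G g = 1 :=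
  (isMulTorsionFree_reflObj G).pow_left_injective hn.ne' (by simpa using h)

variable {E B : GrpCat.{w}} {p : E ⟶ B}

/-- The kernel of a normal extension has no non-trivial element with a power in `[K, E]`. -/
lemma eq_one_of_isNormalExtension (hp : ΓTF.IsNormalExtension p) {k : E} (hk : p.hom k = 1)
    {n : ℕ} (hn : 0 < n) (hkn : k ^ n ∈ ⁅p.hom.ker, (⊤ : Subgroup E)⁆) : k = 1 := by
  let R : GrpCat.{w} := pullback p p
  let fst : R ⟶ E := pullback.fst p p
  let snd : R ⟶ E := pullback.snd p p
  have hpb : IsPullback fst snd p p := IsPullback.of_hasPullback p p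
  have hle : ⁅p.hom.ker, (⊤ : Subgroup E)⁆ ≤
      (⁅(⊤ : Subgroup R), (⊤ : Subgroup R)⁆ ⊓ snd.hom.ker).map fst.hom := by
    refine Subgroup.commutator_le.2 fun k hk e _ => ?_
    obtain ⟨x, hx1, hx2⟩ := exists_of_isPullback hpb k 1
      ((MonoidHom.mem_ker.1 hk).trans (map_one _).symm)
    obtain ⟨y, hy1, hy2⟩ := exists_of_isPullback hpb e e rfl
    refine ⟨⁅x, y⁆, ⟨Subgroup.commutator_mem_commutator trivial trivial, ?_⟩, ?_⟩
    · change snd.hom ⁅x, y⁆ = 1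
      rw [map_commutatorElement]
      exact (congrArg₂ _ hx2 hy2).trans (commutatorElement_one_left e)
    · rw [map_commutatorElement]
      exact congrArg₂ _ hx1 hy1
  obtain ⟨r, ⟨hr, hr2⟩, hr1⟩ := hle hkn
  obtain ⟨x, hx1, hx2⟩ := exists_of_isPullback hpb k 1 (hk.trans (map_one _).symm)
  have hxr : x ^ n = r := by
    refine ext_of_isPullback hpb ?_ ?_
    · rw [map_pow, hx1]; exact hr1.symm
    · rw [map_pow, hx2, one_pow]; exact (MonoidHom.mem_ker.1 hr2).symm
  have hx : reflUnit R x = 1 := (reflUnit_eq_one_iff (G := R) x).2 ⟨n, hn, hxr ▸ hr⟩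
  have : x = 1 := ext_of_isPullback hp.2.2 (hx.trans (map_one (reflUnit R)).symm)
    (hx2.trans (map_one snd.hom).symm)
  rw [← hx1, this, map_one]

lemma commute_of_isNormalExtension (hp : ΓTF.IsNormalExtension p) {k : E} (hk : p.hom k = 1)
    (e : E) : Commute k e := by
  rw [← commutatorElement_eq_one_iff_commute]
  refine eq_one_of_isNormalExtension hp ?_ one_pos ?_
  · rw [map_commutatorElement, hk, commutatorElement_one_left]
  · rw [pow_one]
    exact Subgroup.commutator_mem_commutator hk trivial

lemma surjective_of_isNormalExtension (hp : ΓTF.IsNormalExtension p) :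
    Function.Surjective p.hom :=
  (isRegularEpi_iff_surjective p).1 hp.1.1

/-- Two homomorphisms over the base into a central extension with torsion-free kernel
agree on the elements killed by the torsion-free abelian reflection. -/
lemma eq_of_reflUnit_eq_one {G E B : Type w} [Group G] [Group E] [Group B] {q : E →* B}
    (hc : ∀ k, q k = 1 → ∀ e, Commute k e)
    (ht : ∀ k, q k = 1 → ∀ n : ℕ, 0 < n → k ^ n = 1 → k = 1)
    {φ ψ : G →* E} (h : ∀ g, q (φ g) = q (ψ g)) {g : G} (hg : reflUnit G g = 1) :
    φ g = ψ g := by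
  have hd (g : G) : q (φ g * (ψ g)⁻¹) = 1 := by rw [map_mul, map_inv, h, mul_inv_cancel]
  let c : G →* q.ker :=
    { toFun g := ⟨φ g * (ψ g)⁻¹, hd g⟩
      map_one' := by ext; simp
      map_mul' a b := by
        ext
        change φ (a * b) * (ψ (a * b))⁻¹ = φ a * (ψ a)⁻¹ * (φ b * (ψ b)⁻¹)
        rw [map_mul, map_mul, mul_inv_rev, mul_assoc (φ a) (ψ a)⁻¹,
          ← (hc _ (hd b) (ψ a)⁻¹).eq]
        simp only [mul_assoc] }
  have h1 : IsMulCommutative q.ker := ⟨⟨fun a b => Subtype.ext (hc a a.2 b)⟩⟩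
  have h2 : IsMulTorsionFree q.ker := by
    refine ⟨fun n hn a b hab => ?_⟩
    have hab' : (a : E) ^ n = (b : E) ^ n := congrArg Subtype.val hab
    refine Subtype.ext (mul_inv_eq_one.1 (ht _ (q.ker.mul_mem a.2 (q.ker.inv_mem b.2)) n
      (Nat.pos_of_ne_zero hn) ?_))
    rw [(hc _ a.2 _).mul_pow, inv_pow, hab', mul_inv_cancel]
  have := congrArg Subtype.val (MonoidHom.mem_ker.1 (reflUnit_ker_le h1 h2 c hg))
  exact mul_inv_eq_one.1 this

/-- Central extensions with torsion-free kernel are normal. -/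
lemma isNormalExtension_of_central (hs : Function.Surjective p.hom)
    (hc : ∀ k, p.hom k = 1 → ∀ e, Commute k e)
    (ht : ∀ k, p.hom k = 1 → ∀ n : ℕ, 0 < n → k ^ n = 1 → k = 1) :
    ΓTF.IsNormalExtension p := by
  let R : GrpCat.{w} := pullback p p
  let fst : R ⟶ E := pullback.fst p p
  let snd : R ⟶ E := pullback.snd p p
  have hpb : IsPullback fst snd p p := IsPullback.of_hasPullback p p
  let δ : E ⟶ R := pullback.lift (𝟙 E) (𝟙 E) rfl
  have hδ (e : E) : snd.hom (δ.hom e) = e :=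
    congrArg (fun k => k.hom e) (pullback.lift_snd (𝟙 E) (𝟙 E) (rfl : 𝟙 E ≫ p = 𝟙 E ≫ p))
  have hw (r : R) : p.hom (fst.hom r) = p.hom (snd.hom r) :=
    congrArg (fun k => k.hom r) (pullback.condition (f := p) (g := p))
  refine ⟨isMonadicExtension_of_surjective hs, (isRegularEpi_iff_surjective _).2 fun e => ⟨_, hδ e⟩,
    isPullback_of_exists_of_ext (reflAdj.unit.naturality _).symm (fun y e hye => ?_)
      fun z hz1 hz2 => ?_⟩
  · obtain ⟨r, rfl⟩ := reflUnit_surjective R y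
    have hye' : reflUnit E (snd.hom r) = reflUnit E e :=
      (reflector_map_reflUnit snd r).symm.trans hye
    refine ⟨r * δ.hom ((snd.hom r)⁻¹ * e), ?_, ?_⟩
    · change reflUnit R _ = reflUnit R r
      rw [map_mul, ← reflector_map_reflUnit δ, map_mul, map_inv, hye', inv_mul_cancel]
      exact (congrArg (reflUnit R r * ·) (map_one _)).trans (mul_one _)
    · change snd.hom _ = e
      rw [map_mul, hδ, mul_inv_cancel_left]
  · have h : fst.hom z = snd.hom z := eq_of_reflUnit_eq_one hc ht hw hz1
    exact ext_of_isPullback hpb ((h.trans hz2).trans (map_one fst.hom).symm)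
      (hz2.trans (map_one snd.hom).symm)

end Normal

section GaloisGroup

open scoped ZeroObject

lemma eq_one_of_zero (x : (0 : ΓTF.{w}.Sub).obj) : x = 1 :=
  congrArg (fun k => k.hom.hom x) ((isZero_zero ΓTF.{w}.Sub).eq_of_src (𝟙 _)
    (ObjectProperty.homMk (GrpCat.ofHom 1)))

/-- An injective homomorphism whose image is the common kernel of `a` and `b` is the pullback of
zero along `⟨a, b⟩`. -/
lemma isPullback_zero_of_range {N X Y Z : ΓTF.{w}.Sub} (k : N ⟶ X) (a : X ⟶ Y) (b : X ⟶ Z)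
    (hk : Function.Injective k.hom.hom)
    (hr : ∀ x, (∃ n, k.hom.hom n = x) ↔ a.hom.hom x = 1 ∧ b.hom.hom x = 1) :
    IsPullback k ((isZero_zero ΓTF.{w}.Sub).from_ N) (prod.lift a b)
      ((isZero_zero ΓTF.{w}.Sub).to_ (Y ⨯ Z)) := by
  have hzero {V W : ΓTF.{w}.Sub} (u : V ⟶ 0) (t : 0 ⟶ W) (x : V.obj) :
      (u ≫ t).hom.hom x = 1 :=
    (congrArg t.hom.hom (eq_one_of_zero (u.hom.hom x))).trans (map_one _)
  have hzero' {V W : ΓTF.{w}.Sub} (u : V ⟶ 0) (t : 0 ⟶ W) {g : V ⟶ W}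
      (hg : ∀ x, g.hom.hom x = 1) : g = u ≫ t := by
    ext x
    exact (hg x).trans (hzero u t x).symm
  have hmem (s : PullbackCone (prod.lift a b) ((isZero_zero ΓTF.{w}.Sub).to_ (Y ⨯ Z)))
      (x : s.pt.obj) : s.fst.hom.hom x ∈ k.hom.hom.range := by
    refine (hr _).2 ⟨?_, ?_⟩
    · have h := s.condition =≫ prod.fst
      rw [Category.assoc, prod.lift_fst, Category.assoc] at h
      exact (congrArg (fun k => k.hom.hom x) h).trans (hzero _ _ x)
    · have h := s.condition =≫ prod.snd
      rw [Category.assoc, prod.lift_snd, Category.assoc] at h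
      exact (congrArg (fun k => k.hom.hom x) h).trans (hzero _ _ x)
  have hlift (s : PullbackCone (prod.lift a b) ((isZero_zero ΓTF.{w}.Sub).to_ (Y ⨯ Z)))
      (x : s.pt.obj) : k.hom.hom ((MonoidHom.ofInjective hk).symm ⟨_, hmem s x⟩) =
        s.fst.hom.hom x :=
    congrArg Subtype.val ((MonoidHom.ofInjective hk).apply_symm_apply ⟨_, hmem s x⟩)
  refine ⟨⟨?_⟩, ⟨PullbackCone.IsLimit.mk _
    (fun s => ObjectProperty.homMk (GrpCat.ofHom ((MonoidHom.ofInjective hk).symm.toMonoidHom.comp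
      (s.fst.hom.hom.codRestrict k.hom.hom.range (hmem s)))))
    (fun s => ?_) (fun s => (isZero_zero _).eq_of_tgt _ _) (fun s m hm _ => ?_)⟩⟩
  · apply Limits.prod.hom_ext
    · rw [Category.assoc, prod.lift_fst, Category.assoc]
      exact hzero' _ _ fun x => ((hr _).1 ⟨x, rfl⟩).1
    · rw [Category.assoc, prod.lift_snd, Category.assoc]
      exact hzero' _ _ fun x => ((hr _).1 ⟨x, rfl⟩).2
  · ext x
    exact hlift s x
  · ext x
    exact hk ((congrArg (fun k => k.hom.hom x) hm).trans (hlift s x).symm)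

/-- The Galois group of a normal extension is the part of its kernel killed by the reflection. -/
lemma nonempty_galoisGroup_mulEquiv {E B : GrpCat.{w}} {p : E ⟶ B}
    (hp : ΓTF.IsNormalExtension p) :
    Nonempty ((ΓTF.galoisGroup p).obj ≃* hopfNum p.hom.ker) := by
  let R : GrpCat.{w} := pullback p p
  let fst : R ⟶ E := pullback.fst p p
  let snd : R ⟶ E := pullback.snd p p
  have hpb : IsPullback fst snd p p := IsPullback.of_hasPullback p p
  let δ : E ⟶ R := pullback.lift (𝟙 E) (𝟙 E) rfl
  have hδ1 (e : E) : fst.hom (δ.hom e) = e :=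
    congrArg (fun k => k.hom e) (pullback.lift_fst (𝟙 E) (𝟙 E) (rfl : 𝟙 E ≫ p = 𝟙 E ≫ p))
  have hδ2 (e : E) : snd.hom (δ.hom e) = e :=
    congrArg (fun k => k.hom e) (pullback.lift_snd (𝟙 E) (𝟙 E) (rfl : 𝟙 E ≫ p = 𝟙 E ≫ p))
  have hw (r : R) : p.hom (fst.hom r) = p.hom (snd.hom r) :=
    congrArg (fun k => k.hom r) (pullback.condition (f := p) (g := p))
  let N : ΓTF.{w}.Sub := ⟨GrpCat.of (hopfNum p.hom.ker),
    ⟨⟨fun a b => Subtype.ext (commute_of_isNormalExtension hp a.2.1 b)⟩⟩,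
    ⟨fun n hn a b hab => Subtype.ext (mul_inv_eq_one.1 (eq_one_of_isNormalExtension hp
      (p.hom.ker.mul_mem a.2.1 (p.hom.ker.inv_mem b.2.1)) (Nat.pos_of_ne_zero hn) (by
        have hab' : (a : E) ^ n = (b : E) ^ n := congrArg Subtype.val hab
        rw [(commute_of_isNormalExtension hp a.2.1 _).mul_pow, inv_pow, hab', mul_inv_cancel]
        exact one_mem _)))⟩⟩
  have hj : GrpCat.ofHom (hopfNum p.hom.ker).subtype ≫ p = GrpCat.ofHom 1 ≫ p := by
    ext x
    exact (MonoidHom.mem_ker.1 x.2.1).trans (map_one p.hom).symm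
  let j : GrpCat.of (hopfNum p.hom.ker) ⟶ R := pullback.lift _ _ hj
  have hj1 (x : hopfNum p.hom.ker) : fst.hom (j.hom x) = x :=
    congrArg (fun k => k.hom x) (pullback.lift_fst _ _ hj)
  have hj2 (x : hopfNum p.hom.ker) : snd.hom (j.hom x) = 1 :=
    congrArg (fun k => k.hom x) (pullback.lift_snd _ _ hj)
  let k : N ⟶ ΓTF.I.obj R := ObjectProperty.homMk (j ≫ ΓTF.η R)
  have hk (x : hopfNum p.hom.ker) : k.hom.hom x = reflUnit R (j.hom x) := rfl
  have hinj : Function.Injective k.hom.hom := by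
    refine (injective_iff_map_eq_one _).2 fun x hx => ?_
    have h : j.hom x = 1 := ext_of_isPullback hp.2.2 (hx.trans (map_one (reflUnit R)).symm)
      ((hj2 x).trans (map_one snd.hom).symm)
    refine Subtype.ext ((hj1 x).symm.trans ?_)
    rw [h]
    exact map_one fst.hom
  have hrange (y : (ΓTF.I.obj R).obj) : (∃ n, k.hom.hom n = y) ↔
      (ΓTF.I.map fst).hom.hom y = 1 ∧ (ΓTF.I.map snd).hom.hom y = 1 := by
    constructor
    · rintro ⟨x, rfl⟩
      refine ⟨(reflector_map_reflUnit fst (j.hom x)).trans ?_,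
        (reflector_map_reflUnit snd (j.hom x)).trans ?_⟩
      · rw [hj1]
        exact ((mem_hopfNum_iff p.hom.ker x.1).1 x.2).2
      · rw [hj2]
        exact map_one _
    · rintro ⟨h1, h2⟩
      obtain ⟨r, rfl⟩ := reflUnit_surjective R y
      replace h1 : reflUnit E (fst.hom r) = 1 := (reflector_map_reflUnit fst r).symm.trans h1
      replace h2 : reflUnit E (snd.hom r) = 1 := (reflector_map_reflUnit snd r).symm.trans h2
      let x : hopfNum p.hom.ker := ⟨fst.hom r * (snd.hom r)⁻¹, (mem_hopfNum_iff _ _).2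
        ⟨by rw [MonoidHom.mem_ker, map_mul, map_inv, hw, mul_inv_cancel],
          by rw [map_mul, map_inv, h1, h2, inv_one, mul_one]⟩⟩
      have hr : j.hom x * δ.hom (snd.hom r) = r := by
        refine ext_of_isPullback hpb ?_ ?_
        · rw [map_mul, hj1, hδ1]
          exact inv_mul_cancel_right _ _
        · rw [map_mul, hj2, hδ2, one_mul]
      refine ⟨x, (hk x).trans ?_⟩
      rw [← hr, map_mul, ← reflector_map_reflUnit δ, h2]
      exact ((congrArg (reflUnit R (j.hom x) * ·) (map_one _)).trans (mul_one _)).symm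
  exact ⟨(ΓTF.sub.ι.mapIso (isPullback_zero_of_range k _ _ hinj hrange).isoPullback).symm
    |>.groupIsoToMulEquiv⟩

end GaloisGroup

section Presentation

open scoped commutatorElement

/-- Free groups are projective with respect to surjective homomorphisms. -/
lemma exists_lift_of_isFreeGroup {P E B : Type w} [Group P] [IsFreeGroup P] [Group E] [Group B]
    {q : E →* B} (hq : Function.Surjective q) (f : P →* B) :
    ∃ φ : P →* E, ∀ x, q (φ x) = f x := by
  refine ⟨IsFreeGroup.lift fun a => Function.surjInv hq (f (IsFreeGroup.of a)), fun x => ?_⟩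
  refine DFunLike.congr_fun (IsFreeGroup.ext_hom (f := q.comp _) (g := f) fun a => ?_) x
  rw [MonoidHom.comp_apply, IsFreeGroup.lift_of]
  exact Function.surjInv_eq hq _

variable {B P : Type w} [Group B] [Group P] (f : P →* B)

lemma hopfDen_le (K : Subgroup P) [K.Normal] : hopfDen K ≤ K := fun _ hx => hx.1

/-- The extension `P / D ⟶ B`, for `D` the set of elements of the kernel `K` of `P ⟶ B` with a
power in `[K, P]`. -/
def presentedExtension : GrpCat.of (P ⧸ hopfDen f.ker) ⟶ GrpCat.of B :=
  GrpCat.ofHom (QuotientGroup.lift (hopfDen f.ker) f (hopfDen_le f.ker))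

lemma isNormalExtension_presentedExtension (hf : Function.Surjective f) :
    ΓTF.IsNormalExtension (presentedExtension f) := by
  refine isNormalExtension_of_central (fun b => ?_) (fun k hk e => ?_) (fun k hk n hn hkn => ?_)
  · obtain ⟨x, rfl⟩ := hf b
    exact ⟨QuotientGroup.mk x, rfl⟩
  · obtain ⟨x, rfl⟩ := QuotientGroup.mk_surjective k
    obtain ⟨y, rfl⟩ := QuotientGroup.mk_surjective e
    have hc := Subgroup.commutator_mem_commutator (H₁ := f.ker) (H₂ := ⊤)
      (MonoidHom.mem_ker.2 hk) (Subgroup.mem_top y)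
    rw [← commutatorElement_eq_one_iff_commute]
    exact (QuotientGroup.eq_one_iff _).2 ⟨Subgroup.commutator_le_left _ _ hc, 1, one_pos,
      (pow_one ⁅x, y⁆).symm ▸ hc⟩
  · obtain ⟨x, rfl⟩ := QuotientGroup.mk_surjective k
    obtain ⟨-, m, hm, hxm⟩ := (QuotientGroup.eq_one_iff (x ^ n)).1 hkn
    exact (QuotientGroup.eq_one_iff x).2
      ⟨hk, n * m, Nat.mul_pos hn hm, by rw [pow_mul]; exact hxm⟩

/-- A homomorphism over the base from `P` to a normal extension kills the elements of the kernel
with a power in `[K, P]`. -/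
lemma hopfDen_le_ker {E : GrpCat.{w}} {p : E ⟶ GrpCat.of B} (hp : ΓTF.IsNormalExtension p)
    (φ : P →* E) (hφ : ∀ x, p.hom (φ x) = f x) : hopfDen f.ker ≤ φ.ker := by
  rintro x ⟨hx, n, hn, hxn⟩
  refine eq_one_of_isNormalExtension hp ((hφ x).trans hx) hn ?_
  rw [← map_pow]
  refine (?_ : Subgroup.map φ ⁅f.ker, (⊤ : Subgroup P)⁆ ≤ _) ⟨_, hxn, rfl⟩
  rw [Subgroup.map_commutator]
  refine Subgroup.commutator_mono ?_ le_top
  rintro _ ⟨y, hy, rfl⟩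
  exact (hφ y).trans hy

lemma exists_presentedExtension_lift [IsFreeGroup P] {E : GrpCat.{w}} {p : E ⟶ GrpCat.of B}
    (hp : ΓTF.IsNormalExtension p) :
    ∃ u : GrpCat.of (P ⧸ hopfDen f.ker) ⟶ E, u ≫ p = presentedExtension f := by
  obtain ⟨φ, hφ⟩ := exists_lift_of_isFreeGroup (surjective_of_isNormalExtension hp) f
  refine ⟨GrpCat.ofHom (QuotientGroup.lift _ φ (hopfDen_le_ker f hp φ hφ)), ?_⟩
  ext x
  exact hφ x

lemma isWeaklyUniversal_presentedExtension [IsFreeGroup P] (hf : Function.Surjective f) :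
    ΓTF.IsWeaklyUniversal (presentedExtension f) :=
  ⟨isNormalExtension_presentedExtension f hf, fun _ _ hp => exists_presentedExtension_lift f hp⟩

lemma nonempty_hopfNum_presentedExtension_mulEquiv :
    Nonempty (hopfNum (presentedExtension f).hom.ker ≃* HopfQuotient f.ker) := by
  let π : P →* P ⧸ hopfDen f.ker := QuotientGroup.mk' _
  have hmem (x : P) : π x ∈ hopfNum (presentedExtension f).hom.ker ↔ x ∈ hopfNum f.ker := by
    rw [mem_hopfNum_iff, mem_hopfNum_iff]
    refine and_congr_right fun hx => ⟨fun h => ?_, fun h => ?_⟩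
    · obtain ⟨n, hn, hxn⟩ := (reflUnit_eq_one_iff _).1 h
      refine reflUnit_eq_one_of_pow hn ?_
      rw [← Subgroup.map_top_of_surjective π (QuotientGroup.mk'_surjective _),
        ← Subgroup.map_commutator] at hxn
      obtain ⟨c, hc, hcx⟩ := hxn
      have hd : c⁻¹ * x ^ n ∈ hopfDen f.ker :=
        QuotientGroup.eq.1 (hcx.trans (map_pow π x n).symm)
      have hc' : reflUnit P c = 1 :=
        (reflUnit_eq_one_iff c).2 ⟨1, one_pos, (pow_one c).symm ▸ hc⟩
      have hd' := ((mem_hopfNum_iff _ _).1 (hopfDen_le_hopfNum _ hd)).2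
      rwa [map_mul, map_inv, hc', inv_one, one_mul] at hd'
    · obtain ⟨n, hn, hxn⟩ := (reflUnit_eq_one_iff _).1 h
      refine (reflUnit_eq_one_iff _).2 ⟨n, hn, ?_⟩
      rw [← map_pow, ← Subgroup.map_top_of_surjective π (QuotientGroup.mk'_surjective _),
        ← Subgroup.map_commutator]
      exact ⟨_, hxn, rfl⟩
  let ψ : hopfNum f.ker →* hopfNum (presentedExtension f).hom.ker :=
    (π.comp (hopfNum f.ker).subtype).codRestrict _ fun x => (hmem x).2 x.2
  have hψ : Function.Surjective ψ := by
    rintro ⟨y, hy⟩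
    obtain ⟨x, rfl⟩ := QuotientGroup.mk'_surjective (hopfDen f.ker) y
    exact ⟨⟨x, (hmem x).1 hy⟩, rfl⟩
  have hker : (hopfDen f.ker).subgroupOf (hopfNum f.ker) = ψ.ker := by
    ext x
    refine (QuotientGroup.eq_one_iff (N := hopfDen f.ker) x.1).symm.trans ?_
    exact (Subtype.ext_iff (a1 := ψ x) (a2 := 1)).symm
  exact ⟨((QuotientGroup.quotientMulEquivOfEq hker).trans
    (QuotientGroup.quotientKerEquivOfSurjective ψ hψ)).symm⟩

end Presentation

section Invariance

lemma map_mem_hopfNum {E E' B : GrpCat.{w}} {p : E ⟶ B} {p' : E' ⟶ B} {u : E ⟶ E'}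
    (hu : u ≫ p' = p) {x : E} (hx : x ∈ hopfNum p.hom.ker) : u.hom x ∈ hopfNum p'.hom.ker := by
  rw [mem_hopfNum_iff] at hx ⊢
  refine ⟨MonoidHom.mem_ker.2 ((congrArg (fun k => k.hom x) hu).trans (MonoidHom.mem_ker.1 hx.1)), ?_⟩
  rw [← reflector_map_reflUnit, hx.2]
  exact map_one _

lemma map_map_eq_of_mem_hopfNum {E E' B : GrpCat.{w}} {p : E ⟶ B} {p' : E' ⟶ B}
    (hp : ΓTF.IsNormalExtension p) {u : E ⟶ E'} (hu : u ≫ p' = p) {v : E' ⟶ E} (hv : v ≫ p = p')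
    {x : E} (hx : x ∈ hopfNum p.hom.ker) : v.hom (u.hom x) = x := by
  refine eq_of_reflUnit_eq_one (q := p.hom) (φ := v.hom.comp u.hom) (ψ := MonoidHom.id E)
    (fun k hk e => commute_of_isNormalExtension hp hk e)
    (fun k hk n hn hkn => eq_one_of_isNormalExtension hp hk hn (hkn ▸ one_mem _))
    (fun g => ?_) ((mem_hopfNum_iff _ _).1 hx).2
  refine congrArg (fun k => k.hom g) (?_ : (u ≫ v) ≫ p = p)
  rw [Category.assoc, hv, hu]

/-- Normal extensions which factor through each other have isomorphic Galois groups. -/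
def hopfNumMulEquiv {E E' B : GrpCat.{w}} {p : E ⟶ B} {p' : E' ⟶ B}
    (hp : ΓTF.IsNormalExtension p) (hp' : ΓTF.IsNormalExtension p') {u : E ⟶ E'}
    (hu : u ≫ p' = p) {v : E' ⟶ E} (hv : v ≫ p = p') :
    hopfNum p.hom.ker ≃* hopfNum p'.hom.ker where
  toFun x := ⟨u.hom x, map_mem_hopfNum hu x.2⟩
  invFun y := ⟨v.hom y, map_mem_hopfNum hv y.2⟩
  left_inv x := Subtype.ext (map_map_eq_of_mem_hopfNum hp hu hv x.2)
  right_inv y := Subtype.ext (map_map_eq_of_mem_hopfNum hp' hv hu y.2)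
  map_mul' x y := Subtype.ext (map_mul u.hom x.1 y.1)

end Invariance

end GaloisPiOne

theorem mainTheorem7 (B P : Type w) [Group B] [Group P] [IsFreeGroup P] (f : P →* B)
    (hf : Function.Surjective f) :
    (∃ (E : GrpCat.{w}) (p : E ⟶ GrpCat.of B), GaloisPiOne.ΓTF.IsWeaklyUniversal p) ∧
    ∀ (E : GrpCat.{w}) (p : E ⟶ GrpCat.of B), GaloisPiOne.ΓTF.IsWeaklyUniversal p →
      Nonempty ((GaloisPiOne.ΓTF.galoisGroup p).obj ≃* GaloisPiOne.HopfQuotient f.ker) := by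
  refine ⟨⟨_, _, GaloisPiOne.isWeaklyUniversal_presentedExtension f hf⟩, fun E p hp => ?_⟩
  have hn := GaloisPiOne.isNormalExtension_presentedExtension f hf
  obtain ⟨u, hu⟩ := hp.2 _ _ hn
  obtain ⟨v, hv⟩ := GaloisPiOne.exists_presentedExtension_lift f hp.1
  obtain ⟨e⟩ := GaloisPiOne.nonempty_galoisGroup_mulEquiv hp.1
  obtain ⟨e'⟩ := GaloisPiOne.nonempty_hopfNum_presentedExtension_mulEquiv f
  exact ⟨(e.trans (GaloisPiOne.hopfNumMulEquiv hp.1 hn hu hv)).trans e'⟩
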